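/- A locale is a complete lattice $L$ with $a\wedge\bigvee S=\bigvee_{s\in S}(a\wedge s)$; a localic map $f:L\to M$ is a meet-preserving map whose left adjoint $f^*:M\to L$ preserves finite meets, and $\mathsf{Loc}$ is the category of locales and localic maps. A localic map $f:L\to M$ is closed if $f(\uparrow a)=\uparrow f(a)$ for all $a\in L$. A locale $L$ is strongly Hausdorff if the diagonal $L\to L\times_{\mathsf{Loc}}L$ is closed, and compact if every $S\subseteq L$ with $\bigvee S=1$ has a finite subset $T$ with $\bigvee T=1$. Write $a\prec b$ if $a^{*}\vee b=1$, where $a^*$ is the pseudocomplement of $a$, and $a\prec\!\!\prec b$ if there are elements $x_r$ ($r\in\mathbb{Q}\cap[0,1]$) with $x_0=a$, $x_1=b$ and $x_r\prec x_s$ whenever $r<s$. A locale is regular (respectively completely regular) if each $a$ is the join of all $x\prec a$ (respectively $x\prec\!\!\prec a$). Let $\mathsf{HLoc}$ be the full subcategory of $\mathsf{Loc}$ of strongly Hausdorff locales and $\mathsf{KHLoc}$ its full subcategory of compact strongly Hausdorff locales. A reflection of $X$ in a full subcategory is an arrow from $X$ to an object of the subcategory through which every arrow from $X$ to an object of the subcategory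 factors uniquely. (1) $\mathsf{KHLoc}$ is a reflective subcategory of $\mathsf{HLoc}$. (2) Every locale $L$ has a reflection $r:L\to C$ in the completely regular locales, every completely regular locale $C$ has a reflection $s:C\to B$ in the compact regular locales, and, if $L$ is strongly Hausdorff, the composite $s\circ r:L\to B$ of such arrows is a reflection of $L$ in $\mathsf{KHLoc}$. (3) If $K$ and $K'$ are compact strongly Hausdorff locales, then their product $K\times_{\mathsf{HLoc}}K'$ in $\mathsf{HLoc}$ exists and is a compact locale. -/

import Mathlib

open CategoryTheory CategoryTheory.Limits

universe u v

/-! ### Binary products of locales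

The product of two locales is the coproduct of the underlying frames, realised as the frame of
those lower sets of `A × B` that are closed under joins in each variable separately. -/

namespace FrameCoprod

variable {A B : Type u} [Order.Frame A] [Order.Frame B]

/-- The lower sets of `A × B` that are closed under joins in each variable, as a sublocale of the
frame of all lower sets. -/
def cIdeals (A B : Type u) [Order.Frame A] [Order.Frame B] : Sublocale (LowerSet (A × B)) where
  carrier := {U | (∀ (S : Set A) (b : B), (∀ a ∈ S, (a, b) ∈ U) → (sSup S, b) ∈ U) ∧
    (∀ (a : A) (S : Set B), (∀ b ∈ S, (a, b) ∈ U) → (a, sSup S) ∈ U)}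
  sInf_mem' s hs := by
    refine ⟨fun S b h => ?_, fun a S h => ?_⟩
    · simp only [LowerSet.mem_sInf_iff] at h ⊢
      exact fun U hU => (hs hU).1 S b fun a ha => h a ha U hU
    · simp only [LowerSet.mem_sInf_iff] at h ⊢
      exact fun U hU => (hs hU).2 a S fun b hb => h b hb U hU
  himp_mem' U V hV := by
    have key : ∀ p : A × B, p ∈ U ⇨ V ↔ ∀ q ∈ U, p ⊓ q ∈ V := by
      intro p
      rw [← LowerSet.Iic_le, le_himp_iff]
      constructor
      · intro h q hq
        exact h ⟨(LowerSet.mem_Iic_iff.2 inf_le_left), U.lower inf_le_right hq⟩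
      · rintro h q ⟨hq, hqU⟩
        have := h q hqU
        rwa [inf_eq_right.2 (LowerSet.mem_Iic_iff.1 hq)] at this
    refine ⟨fun S b h => ?_, fun a S h => ?_⟩
    · rw [key]
      rintro ⟨x, y⟩ hxy
      change (sSup S ⊓ x, b ⊓ y) ∈ V
      rw [sSup_inf_eq, ← sSup_image]
      refine hV.1 _ _ ?_
      rintro _ ⟨a, ha, rfl⟩
      exact (key _).1 (h a ha) (x, y) hxy
    · rw [key]
      rintro ⟨x, y⟩ hxy
      change (a ⊓ x, sSup S ⊓ y) ∈ V
      rw [sSup_inf_eq, ← sSup_image]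
      refine hV.2 _ _ ?_
      rintro _ ⟨b, hb, rfl⟩
      exact (key _).1 (h b hb) (x, y) hxy

/-- The coproduct of two frames. -/
abbrev Obj (A B : Type u) [Order.Frame A] [Order.Frame B] : Type u := cIdeals A B

theorem le_def {U V : Obj A B} : U ≤ V ↔ ∀ p, p ∈ U.1 → p ∈ V.1 := Iff.rfl

theorem left_bot_mem (U : Obj A B) (b : B) : ((⊥ : A), b) ∈ U.1 := by
  simpa using U.2.1 ∅ b (by simp)

theorem right_bot_mem (U : Obj A B) (a : A) : (a, (⊥ : B)) ∈ U.1 := by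
  simpa using U.2.2 a ∅ (by simp)

theorem mem_inf {U V : Obj A B} {p : A × B} : p ∈ (U ⊓ V).1 ↔ p ∈ U.1 ∧ p ∈ V.1 := Iff.rfl

/-- A frame homomorphism is determined by a monotone map preserving `⊤`, `⊓` and having a right
adjoint. -/
def homOfGC {X Y : Type*} [Order.Frame X] [Order.Frame Y] (l : X → Y) (r : Y → X)
    (gc : GaloisConnection l r) (htop : l ⊤ = ⊤) (hinf : ∀ x y, l (x ⊓ y) = l x ⊓ l y) :
    FrameHom X Y where
  toFun := l
  map_inf' := hinf
  map_top' := htop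
  map_sSup' s := by rw [gc.l_sSup, sSup_image]

/-- The generator `a ⊗ b`: the least element of the coproduct containing `(a, b)`. -/
def tmul (a : A) (b : B) : Obj A B :=
  ⟨⟨{p | p.1 = ⊥ ∨ p.2 = ⊥ ∨ (p.1 ≤ a ∧ p.2 ≤ b)}, by
    rintro ⟨x, y⟩ ⟨x', y'⟩ ⟨h1, h2⟩ h
    dsimp at h1 h2
    rcases h with h | h | h
    · exact Or.inl (le_bot_iff.1 (h1.trans h.le))
    · exact Or.inr (Or.inl (le_bot_iff.1 (h2.trans h.le)))
    · exact Or.inr (Or.inr ⟨h1.trans h.1, h2.trans h.2⟩)⟩, by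
    refine ⟨fun S y h => ?_, fun x S h => ?_⟩
    · change sSup S = ⊥ ∨ y = ⊥ ∨ (sSup S ≤ a ∧ y ≤ b)
      by_cases hy : y = ⊥
      · exact Or.inr (Or.inl hy)
      by_cases hS : ∃ x ∈ S, x ≠ ⊥
      · obtain ⟨x, hx, hx0⟩ := hS
        refine Or.inr (Or.inr ⟨sSup_le fun z hz => ?_, ?_⟩)
        · rcases h z hz with h | h | h
          · exact h.le.trans bot_le
          · exact absurd h hy
          · exact h.1
        · rcases h x hx with h | h | h
          · exact absurd h hx0
          · exact absurd h hy
          · exact h.2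
      · push Not at hS
        exact Or.inl (sSup_eq_bot.2 hS)
    · change x = ⊥ ∨ sSup S = ⊥ ∨ (x ≤ a ∧ sSup S ≤ b)
      by_cases hx : x = ⊥
      · exact Or.inl hx
      by_cases hS : ∃ y ∈ S, y ≠ ⊥
      · obtain ⟨y, hy, hy0⟩ := hS
        refine Or.inr (Or.inr ⟨?_, sSup_le fun z hz => ?_⟩)
        · rcases h y hy with h | h | h
          · exact absurd h hx
          · exact absurd h hy0
          · exact h.1
        · rcases h z hz with h | h | h
          · exact absurd h hx
          · exact h.le.trans bot_le
          · exact h.2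
      · push Not at hS
        exact Or.inr (Or.inl (sSup_eq_bot.2 hS))⟩

theorem mem_tmul {a : A} {b : B} {p : A × B} :
    p ∈ (tmul a b).1 ↔ p.1 = ⊥ ∨ p.2 = ⊥ ∨ (p.1 ≤ a ∧ p.2 ≤ b) := Iff.rfl

theorem tmul_le {a : A} {b : B} {U : Obj A B} : tmul a b ≤ U ↔ (a, b) ∈ U.1 := by
  constructor
  · exact fun h => le_def.1 h _ (mem_tmul.2 (Or.inr (Or.inr ⟨le_rfl, le_rfl⟩)))
  · rintro h
    rw [le_def]
    rintro ⟨x, y⟩ hp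
    rcases mem_tmul.1 hp with h' | h' | h'
    · obtain rfl : x = ⊥ := h'
      exact left_bot_mem U y
    · obtain rfl : y = ⊥ := h'
      exact right_bot_mem U x
    · exact U.1.lower (show (x, y) ≤ (a, b) from h') h

theorem tmul_inf (a a' : A) (b b' : B) : tmul (a ⊓ a') (b ⊓ b') = tmul a b ⊓ tmul a' b' := by
  apply le_antisymm
  · rw [tmul_le, mem_inf, mem_tmul, mem_tmul]
    exact ⟨Or.inr (Or.inr ⟨inf_le_left, inf_le_left⟩),
      Or.inr (Or.inr ⟨inf_le_right, inf_le_right⟩)⟩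
  · rw [le_def]
    rintro p hp
    rw [mem_inf, mem_tmul, mem_tmul] at hp
    rw [mem_tmul]
    rcases hp with ⟨h | h | h, h' | h' | h'⟩
    all_goals first
      | exact Or.inl (by assumption)
      | exact Or.inr (Or.inl (by assumption))
      | exact Or.inr (Or.inr ⟨le_inf h.1 h'.1, le_inf h.2 h'.2⟩)

theorem tmul_top : tmul (⊤ : A) (⊤ : B) = ⊤ :=
  top_le_iff.1 (le_def.2 fun _ _ => Or.inr (Or.inr ⟨le_top, le_top⟩))

/-- The first coproduct inclusion. -/
def inl : FrameHom A (Obj A B) :=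
  homOfGC (fun a => tmul a ⊤) (fun U => sSup {a | (a, ⊤) ∈ U.1})
    (fun a U => by
      rw [tmul_le]
      constructor
      · exact fun h => le_sSup h
      · intro h
        exact U.1.lower (show (a, (⊤ : B)) ≤ (sSup {a | (a, ⊤) ∈ U.1}, ⊤) from ⟨h, le_rfl⟩)
          (U.2.1 _ _ fun _ h => h))
    tmul_top (fun x y => by rw [← tmul_inf, inf_idem])

/-- The second coproduct inclusion. -/
def inr : FrameHom B (Obj A B) :=
  homOfGC (fun b => tmul ⊤ b) (fun U => sSup {b | (⊤, b) ∈ U.1})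
    (fun b U => by
      rw [tmul_le]
      constructor
      · exact fun h => le_sSup h
      · intro h
        exact U.1.lower (show ((⊤ : A), b) ≤ (⊤, sSup {b | (⊤, b) ∈ U.1}) from ⟨le_rfl, h⟩)
          (U.2.2 _ _ fun _ h => h))
    tmul_top (fun x y => by rw [← tmul_inf, inf_idem])

theorem inl_inf_inr (a : A) (b : B) : inl a ⊓ inr b = tmul a b := by
  change tmul a ⊤ ⊓ tmul ⊤ b = _
  rw [← tmul_inf, inf_top_eq, top_inf_eq]

theorem eq_sSup (U : Obj A B) : U = sSup {V | ∃ p ∈ U.1, V = tmul p.1 p.2} := by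
  apply le_antisymm
  · rw [le_def]
    rintro p hp
    exact tmul_le.1 (le_sSup ⟨p, hp, rfl⟩)
  · apply sSup_le
    rintro _ ⟨p, hp, rfl⟩
    exact tmul_le.2 hp

variable {F : Type u} [Order.Frame F]

/-- The map out of the coproduct induced by two frame homomorphisms. -/
def desc (f : FrameHom A F) (g : FrameHom B F) : FrameHom (Obj A B) F :=
  homOfGC (fun U => ⨆ p ∈ U.1, f p.1 ⊓ g p.2)
    (fun z => ⟨⟨{p | f p.1 ⊓ g p.2 ≤ z}, fun p q h hp =>
      (inf_le_inf (OrderHomClass.mono f h.1) (OrderHomClass.mono g h.2)).trans hp⟩, by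
      refine ⟨fun S b h => ?_, fun a S h => ?_⟩
      · change f (sSup S) ⊓ g b ≤ z
        rw [map_sSup, sSup_inf_eq, iSup₂_le_iff]
        rintro _ ⟨a, ha, rfl⟩
        exact h a ha
      · change f a ⊓ g (sSup S) ≤ z
        rw [map_sSup, inf_sSup_eq, iSup₂_le_iff]
        rintro _ ⟨b, hb, rfl⟩
        exact h b hb⟩)
    (fun U z => by rw [iSup₂_le_iff]; rfl)
    (top_le_iff.1 (le_iSup₂_of_le ((⊤ : A), (⊤ : B)) trivial (by simp)))
    (fun U V => by
      apply le_antisymm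
      · refine le_inf ?_ ?_
        · exact iSup₂_le fun p hp => le_iSup₂_of_le p (mem_inf.1 hp).1 le_rfl
        · exact iSup₂_le fun p hp => le_iSup₂_of_le p (mem_inf.1 hp).2 le_rfl
      · simp only [iSup_inf_eq, inf_iSup_eq]
        refine iSup₂_le fun p hp => iSup₂_le fun q hq => ?_
        refine le_iSup₂_of_le (p ⊓ q)
          (mem_inf.2 ⟨U.1.lower inf_le_right hq, V.1.lower inf_le_left hp⟩) ?_
        simp only [Prod.fst_inf, Prod.snd_inf, map_inf]
        rw [inf_inf_inf_comm, inf_comm (f p.1), inf_comm (g p.2)])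

theorem desc_tmul (f : FrameHom A F) (g : FrameHom B F) (a : A) (b : B) :
    desc f g (tmul a b) = f a ⊓ g b := by
  apply le_antisymm
  · refine iSup₂_le fun p hp => ?_
    rcases mem_tmul.1 hp with h | h | h
    · simp [h]
    · simp [h]
    · exact inf_le_inf (OrderHomClass.mono f h.1) (OrderHomClass.mono g h.2)
  · exact le_iSup₂_of_le (f := fun (p : A × B) (_ : p ∈ (tmul a b).1) => f p.1 ⊓ g p.2) (a, b)
      (mem_tmul.2 (Or.inr (Or.inr ⟨le_rfl, le_rfl⟩))) le_rfl

theorem desc_comp_inl (f : FrameHom A F) (g : FrameHom B F) : (desc f g).comp inl = f := by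
  ext a
  exact (desc_tmul f g a ⊤).trans (by simp)

theorem desc_comp_inr (f : FrameHom A F) (g : FrameHom B F) : (desc f g).comp inr = g := by
  ext b
  exact (desc_tmul f g ⊤ b).trans (by simp)

theorem hom_ext {h k : FrameHom (Obj A B) F} (hl : h.comp inl = k.comp inl)
    (hr : h.comp inr = k.comp inr) : h = k := by
  ext U
  rw [eq_sSup U, map_sSup, map_sSup]
  congr 1
  apply Set.image_congr
  rintro _ ⟨p, -, rfl⟩
  rw [← inl_inf_inr, map_inf, map_inf]
  exact congr_arg₂ _ (DFunLike.congr_fun hl p.1) (DFunLike.congr_fun hr p.2)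

end FrameCoprod

namespace Locale

/-- The frame homomorphism `f* : M → L` of a localic map `f : L ⟶ M`. -/
def frameHom {L M : Locale.{u}} (f : L ⟶ M) : FrameHom M L :=
  Frm.Hom.hom (Quiver.Hom.unop f)

/-- The localic map given by a frame homomorphism. -/
def homOf {L M : Locale.{u}} (f : FrameHom M L) : L ⟶ M :=
  Quiver.Hom.op (Frm.ofHom f)

theorem hom_ext {L M : Locale.{u}} {f g : L ⟶ M} (h : frameHom f = frameHom g) : f = g :=
  Quiver.Hom.unop_inj (Frm.hom_ext h)

theorem frameHom_comp {L M N : Locale.{u}} (f : L ⟶ M) (g : M ⟶ N) :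
    frameHom (f ≫ g) = (frameHom f).comp (frameHom g) := rfl

/-- The product of two locales, given by the coproduct of the frames, with its projections. -/
def prodFan (L M : Locale.{u}) : BinaryFan L M :=
  BinaryFan.mk (P := Locale.of (FrameCoprod.Obj L M)) (homOf FrameCoprod.inl)
    (homOf FrameCoprod.inr)

/-- `prodFan L M` is a product of `L` and `M` in the category of locales. -/
def prodFanIsLimit (L M : Locale.{u}) : IsLimit (prodFan L M) :=
  BinaryFan.IsLimit.mk _ (fun f g => homOf (FrameCoprod.desc (frameHom f) (frameHom g)))
    (fun f g => hom_ext (FrameCoprod.desc_comp_inl (frameHom f) (frameHom g)))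
    (fun f g => hom_ext (FrameCoprod.desc_comp_inr (frameHom f) (frameHom g)))
    (fun _ _ _ h₁ h₂ => hom_ext (FrameCoprod.hom_ext
      ((congr_arg frameHom h₁).trans (FrameCoprod.desc_comp_inl _ _).symm)
      ((congr_arg frameHom h₂).trans (FrameCoprod.desc_comp_inr _ _).symm)))

instance hasBinaryProducts : HasBinaryProducts Locale.{u} :=
  have : ∀ {L M : Locale.{u}}, HasLimit (pair L M) := fun {L M} =>
    ⟨⟨⟨prodFan L M, prodFanIsLimit L M⟩⟩⟩
  hasBinaryProducts_of_hasLimit_pair _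

/-! ### Strongly Hausdorff, compact, regular and completely regular locales -/

/-- The underlying map `L → M` of a localic map `f : L ⟶ M`, the right adjoint of `f*`. -/
def direct {L M : Locale.{u}} (f : L ⟶ M) (a : L) : M :=
  sSup {b : M | frameHom f b ≤ a}

theorem gc_direct {L M : Locale.{u}} (f : L ⟶ M) :
    GaloisConnection (frameHom f) (direct f) := by
  intro b a
  constructor
  · exact fun h => le_sSup h
  · intro h
    refine (OrderHomClass.mono (frameHom f) h).trans ?_
    rw [direct, map_sSup, sSup_le_iff]
    rintro _ ⟨c, hc, rfl⟩
    exact hc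

/-- A localic map is closed if the image of each closed sublocale `↑a` is the closed sublocale
`↑(f a)`. -/
def IsClosedMap {L M : Locale.{u}} (f : L ⟶ M) : Prop :=
  ∀ a : L, direct f '' Set.Ici a = Set.Ici (direct f a)

/-- A locale is strongly Hausdorff if its diagonal `L ⟶ L ⨯ L` (product in the category of
locales) is closed. -/
def stronglyHausdorff : ObjectProperty Locale.{u} := fun L => IsClosedMap (diag L)

/-- A locale is compact if every cover has a finite subcover. -/
def compact : ObjectProperty Locale.{u} := fun L =>
  ∀ S : Set L, sSup S = ⊤ → ∃ T ⊆ S, T.Finite ∧ sSup T = ⊤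

/-- The relation "rather below": `a ≺ b` if `aᶜ ⊔ b = ⊤`, with `aᶜ` the pseudocomplement. -/
def RatherBelow {L : Locale.{u}} (a b : L) : Prop := aᶜ ⊔ b = ⊤

/-- The relation "completely below": `a ≺≺ b` if there is a family `(x r)`, indexed by the
rationals `0 ≤ r ≤ 1`, from `a` to `b` with `x r ≺ x s` whenever `r < s`. -/
def CompletelyBelow {L : Locale.{u}} (a b : L) : Prop :=
  ∃ x : Set.Icc (0 : ℚ) 1 → L, x 0 = a ∧ x 1 = b ∧ ∀ r s, r < s → RatherBelow (x r) (x s)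

/-- A locale is regular if each element is the join of the elements rather below it. -/
def regular : ObjectProperty Locale.{u} := fun L =>
  ∀ a : L, a = sSup {x : L | RatherBelow x a}

/-- A locale is completely regular if each element is the join of the elements completely below
it. -/
def completelyRegular : ObjectProperty Locale.{u} := fun L =>
  ∀ a : L, a = sSup {x : L | CompletelyBelow x a}

/-- The category of strongly Hausdorff locales, a full subcategory of the category of locales. -/
abbrev HLoc : Type (u + 1) := (stronglyHausdorff.{u}).FullSubcategory

/-- The category of compact strongly Hausdorff locales. -/
abbrev KHLoc : Type (u + 1) := (compact.{u} ⊓ stronglyHausdorff.{u}).FullSubcategory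

/-- The inclusion functor of `KHLoc` into `HLoc`. -/
abbrev inclKHLoc : KHLoc.{u} ⥤ HLoc.{u} := ObjectProperty.ιOfLE inf_le_right

end Locale

/-- `r : X ⟶ Y` is a reflection of `X` into the full subcategory of objects satisfying `P`:
`Y` satisfies `P`, and every morphism from `X` to an object satisfying `P` factors uniquely
through `r`. -/
def IsReflectionArrow {C : Type u} [Category.{v} C] (P : ObjectProperty C) {X Y : C}
    (r : X ⟶ Y) : Prop :=
  P Y ∧ ∀ Z : C, P Z → ∀ f : X ⟶ Z, ∃! g : Y ⟶ Z, r ≫ g = f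

/-! The core is that compact strongly Hausdorff and compact regular locales coincide
(`compact_inf_regular_eq`). A closed diagonal gives `inl a ≤ offDiag L ⊔ inr a` in the square, and
compactness turns this into regularity (`le_of_inl_le_offDiag_sup_inr`). Conversely, in a regular
locale the two inclusions agree modulo anything above `offDiag L`, so such an element is determined
by its restriction to the diagonal.

The completely regular reflection is a subframe (`crSubframe`); the compact regular one is the frame
of regular ideals, where `extend` gives existence of factorizations and `mem_of_ratherBelow`
uniqueness. Compactness makes `≺` interpolative on a regular locale, so compact regular locales are
completely regular and the two reflections compose.

For products, the projections of the localic product of two compact Hausdorff locales extend along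
its reflection arrow, which is therefore invertible. The product is thus compact and strongly
Hausdorff without a direct Tychonoff argument. -/

namespace Locale

/-! ### Calculus of the relations `≺` and `≺≺`. -/

section Below

variable {L M : Locale.{u}} {a b c d : L}

theorem ratherBelow_iff : RatherBelow a b ↔ ∃ c : L, c ⊓ a = ⊥ ∧ c ⊔ b = ⊤ := by
  constructor
  · exact fun h => ⟨aᶜ, compl_inf_self a, h⟩
  · rintro ⟨c, h, h'⟩
    exact top_le_iff.1 (h'.ge.trans (sup_le_sup_right (le_compl_iff_disjoint_right.2
      (disjoint_iff.2 h)) b))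

theorem RatherBelow.le (h : RatherBelow a b) : a ≤ b := by
  have : a ⊓ (aᶜ ⊔ b) ≤ b := by
    rw [inf_sup_left, inf_compl_self, bot_sup_eq]
    exact inf_le_right
  rwa [h, inf_top_eq] at this

theorem RatherBelow.mono (h : RatherBelow a b) (hc : c ≤ a) (hd : b ≤ d) : RatherBelow c d :=
  top_le_iff.1 (h.ge.trans (sup_le_sup (compl_le_compl hc) hd))

theorem RatherBelow.inf (h : RatherBelow a b) (h' : RatherBelow c d) :
    RatherBelow (a ⊓ c) (b ⊓ d) := by
  unfold RatherBelow
  rw [sup_inf_left, inf_eq_top_iff]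
  exact ⟨h.mono inf_le_left le_rfl, h'.mono inf_le_right le_rfl⟩

theorem RatherBelow.sup (h : RatherBelow a b) (h' : RatherBelow c d) :
    RatherBelow (a ⊔ c) (b ⊔ d) := by
  unfold RatherBelow
  rw [compl_sup, sup_inf_right, inf_eq_top_iff]
  exact ⟨h.mono le_rfl le_sup_left, h'.mono le_rfl le_sup_right⟩

theorem ratherBelow_bot (a : L) : RatherBelow ⊥ a := by simp [RatherBelow]

theorem ratherBelow_top (a : L) : RatherBelow a ⊤ := by simp [RatherBelow]

theorem RatherBelow.compl (h : RatherBelow a b) : RatherBelow bᶜ aᶜ :=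
  ratherBelow_iff.2 ⟨b, inf_compl_self b, sup_comm b aᶜ ▸ h⟩

theorem RatherBelow.map (h : RatherBelow a b) (f : FrameHom L M) : RatherBelow (f a) (f b) :=
  ratherBelow_iff.2 ⟨f aᶜ, by rw [← map_inf, compl_inf_self, map_bot],
    by rw [← map_sup, h, map_top]⟩

theorem CompletelyBelow.ratherBelow (h : CompletelyBelow a b) : RatherBelow a b := by
  obtain ⟨x, rfl, rfl, hx⟩ := h
  exact hx 0 1 (zero_lt_one (α := ℚ))

theorem CompletelyBelow.le (h : CompletelyBelow a b) : a ≤ b := h.ratherBelow.le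

theorem CompletelyBelow.inf (h : CompletelyBelow a b) (h' : CompletelyBelow c d) :
    CompletelyBelow (a ⊓ c) (b ⊓ d) := by
  obtain ⟨x, rfl, rfl, hx⟩ := h
  obtain ⟨y, rfl, rfl, hy⟩ := h'
  exact ⟨fun r => x r ⊓ y r, rfl, rfl, fun r s h => (hx r s h).inf (hy r s h)⟩

theorem CompletelyBelow.sup (h : CompletelyBelow a b) (h' : CompletelyBelow c d) :
    CompletelyBelow (a ⊔ c) (b ⊔ d) := by
  obtain ⟨x, rfl, rfl, hx⟩ := h
  obtain ⟨y, rfl, rfl, hy⟩ := h'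
  exact ⟨fun r => x r ⊔ y r, rfl, rfl, fun r s h => (hx r s h).sup (hy r s h)⟩

theorem CompletelyBelow.map (h : CompletelyBelow a b) (f : FrameHom L M) :
    CompletelyBelow (f a) (f b) := by
  obtain ⟨x, rfl, rfl, hx⟩ := h
  exact ⟨fun r => f (x r), rfl, rfl, fun r s h => (hx r s h).map f⟩

/-- A family indexed by all rationals, increasing for `≺`, yields instances of `≺≺`. -/
theorem completelyBelow_of_rat (x : ℚ → L) {p q : ℚ} (hpq : p < q)
    (hx : ∀ r s, p ≤ r → r < s → s ≤ q → RatherBelow (x r) (x s)) :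
    CompletelyBelow (x p) (x q) := by
  refine ⟨fun r => x (p + r * (q - p)), by simp, by simp, fun r s h => hx _ _ ?_ ?_ ?_⟩
  · exact le_add_of_nonneg_right (mul_nonneg r.2.1 (sub_pos.2 hpq).le)
  · have := mul_lt_mul_of_pos_right (show (r : ℚ) < s from h) (sub_pos.2 hpq)
    linarith
  · have := mul_le_mul_of_nonneg_right s.2.2 (sub_pos.2 hpq).le
    linarith

theorem CompletelyBelow.exists_rat (h : CompletelyBelow a b) :
    ∃ x : ℚ → L, x 0 = a ∧ x 1 = b ∧
      ∀ r s, 0 ≤ r → r < s → s ≤ 1 → RatherBelow (x r) (x s) := by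
  obtain ⟨x, rfl, rfl, hx⟩ := h
  have h0 : Set.projIcc (0 : ℚ) 1 zero_le_one 0 = 0 := Set.projIcc_left _
  have h1 : Set.projIcc (0 : ℚ) 1 zero_le_one 1 = 1 := Set.projIcc_right _
  refine ⟨fun r => x (Set.projIcc 0 1 zero_le_one r), congr_arg x h0, congr_arg x h1,
    fun r s h0 h h1 => hx _ _ ?_⟩
  rw [Set.projIcc_of_mem _ ⟨h0, h.le.trans h1⟩, Set.projIcc_of_mem _ ⟨h0.trans h.le, h1⟩]
  exact h

theorem CompletelyBelow.compl (h : CompletelyBelow a b) : CompletelyBelow bᶜ aᶜ := by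
  obtain ⟨x, rfl, rfl, hx⟩ := h.exists_rat
  have := completelyBelow_of_rat (fun r => (x (1 - r))ᶜ) zero_lt_one fun r s h0 h h1 =>
    (hx (1 - s) (1 - r) (by linarith) (by linarith) (by linarith)).compl
  simpa using this

theorem CompletelyBelow.exists_between (h : CompletelyBelow a b) :
    ∃ c, CompletelyBelow a c ∧ CompletelyBelow c b := by
  obtain ⟨x, rfl, rfl, hx⟩ := h.exists_rat
  refine ⟨x (1 / 2), completelyBelow_of_rat x (by norm_num) fun r s h0 h h1 => ?_,
    completelyBelow_of_rat x (by norm_num) fun r s h0 h h1 => ?_⟩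
  · exact hx r s h0 h (h1.trans (by norm_num))
  · exact hx r s (le_trans (by norm_num) h0) h h1

theorem CompletelyBelow.mono (h : CompletelyBelow a b) (hc : c ≤ a) (hd : b ≤ d) :
    CompletelyBelow c d := by
  obtain ⟨x, rfl, rfl, hx⟩ := h.exists_rat
  -- Only the two end values change; the interior of the chain is kept.
  have := completelyBelow_of_rat (fun r => if r ≤ 0 then c else if r < 1 then x r else d)
    zero_lt_one fun r s h0 h h1 => by
      have hs : ¬ s ≤ 0 := not_le.2 (h0.trans_lt h)
      have hr : r < 1 := h.trans_le h1
      simp only [hs, hr, if_false, if_true]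
      refine (hx r s h0 h h1).mono ?_ ?_
      · split_ifs with hr0
        · obtain rfl : r = 0 := le_antisymm hr0 h0
          exact hc
        · exact le_rfl
      · split_ifs with hs1
        · exact le_rfl
        · obtain rfl : s = 1 := le_antisymm h1 (not_lt.1 hs1)
          exact hd
  simpa [not_le.2 (zero_lt_one (α := ℚ))] using this

theorem completelyBelow_bot (a : L) : CompletelyBelow ⊥ a :=
  CompletelyBelow.mono ⟨fun _ => ⊥, rfl, rfl, fun _ _ _ => ratherBelow_bot _⟩ le_rfl bot_le

theorem completelyBelow_top (a : L) : CompletelyBelow a ⊤ :=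
  CompletelyBelow.mono ⟨fun _ => ⊤, rfl, rfl, fun _ _ _ => ratherBelow_top _⟩ le_top le_rfl

end Below

/-! ### Dyadic interpolation. -/

section Dyadic

variable {α : Type*} (m : α → α → α) (a b : α)

/-- The values at `k / 2 ^ n` of the family obtained from `a` at `0` and `b` at `1` by repeatedly
inserting the intermediate elements chosen by `m`. -/
def dyadic : ℕ → ℕ → α
  | 0, k => if k = 0 then a else b
  | n + 1, k =>
    if k % 2 = 0 then dyadic n (k / 2) else m (dyadic n (k / 2)) (dyadic n (k / 2 + 1))

theorem dyadic_zero (n : ℕ) : dyadic m a b n 0 = a := by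
  induction n with
  | zero => simp [dyadic]
  | succ n ih => simp [dyadic, ih]

theorem dyadic_two_mul (n k : ℕ) : dyadic m a b (n + 1) (2 * k) = dyadic m a b n k := by
  simp [dyadic]

/-- The value thus depends only on the dyadic rational `k / 2 ^ n`, so values of different levels
can be compared over a common denominator. -/
theorem dyadic_mul_two_pow (n j k : ℕ) :
    dyadic m a b (n + j) (k * 2 ^ j) = dyadic m a b n k := by
  induction j with
  | zero => simp
  | succ j ih => rw [← ih, ← dyadic_two_mul m a b (n + j), ← add_assoc]; congr 1; ring

theorem dyadic_two_pow (n : ℕ) : dyadic m a b n (2 ^ n) = b := by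
  simpa [dyadic] using dyadic_mul_two_pow m a b 0 n 1

variable {m a b} {P : α → α → Prop}

/-- Each step at level `n + 1` is the left or right half of a step at level `n`, according to the
parity of `k`. -/
theorem dyadic_rel (hm : ∀ x y, P x y → P x (m x y) ∧ P (m x y) y) (hab : P a b) (n : ℕ) :
    ∀ k < 2 ^ n, P (dyadic m a b n k) (dyadic m a b n (k + 1)) := by
  induction n with
  | zero =>
    intro k hk
    obtain rfl : k = 0 := by simpa using hk
    simpa [dyadic] using hab
  | succ n ih =>
    intro k hk
    rw [pow_succ] at hk
    have := hm _ _ (ih (k / 2) (by omega))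
    rcases Nat.mod_two_eq_zero_or_one k with h | h
    · have h1 : (k + 1) % 2 = 1 := by omega
      have h2 : (k + 1) / 2 = k / 2 := by omega
      simpa [dyadic, h, h1, h2] using this.1
    · have h1 : (k + 1) % 2 = 0 := by omega
      have h2 : (k + 1) / 2 = k / 2 + 1 := by omega
      simpa [dyadic, h, h1, h2] using this.2

theorem dyadic_le [Preorder α] (hP : ∀ x y, P x y → x ≤ y)
    (hm : ∀ x y, P x y → P x (m x y) ∧ P (m x y) y) (hab : P a b) {n k l : ℕ} (hkl : k ≤ l)
    (hl : l ≤ 2 ^ n) : dyadic m a b n k ≤ dyadic m a b n l := by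
  induction l, hkl using Nat.le_induction with
  | base => exact le_rfl
  | succ l _ ih => exact (ih (by omega)).trans (hP _ _ (dyadic_rel hm hab n l hl))

end Dyadic

/-- An interpolative relation contained in `≺` is contained in `≺≺`. -/
theorem completelyBelow_of_interpolative {L : Locale.{u}} (P : L → L → Prop)
    (hP : ∀ x y, P x y → RatherBelow x y) (hi : ∀ x y, P x y → ∃ z, P x z ∧ P z y) {a b : L}
    (hab : P a b) : CompletelyBelow a b := by
  have hm : ∃ m : L → L → L, ∀ x y, P x y → P x (m x y) ∧ P (m x y) y := by
    choose! m hm using hi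
    exact ⟨m, hm⟩
  obtain ⟨m, hm⟩ := hm
  have hle : ∀ x y, P x y → x ≤ y := fun x y h => (hP x y h).le
  -- The value at a rational `r` will be the join of the dyadic values at points up to `r`; `k ≤ 2 ^
  -- n` keeps these points where the family is known to increase.
  let S : ℚ → Set L := fun r => {z | ∃ n k : ℕ, k ≤ 2 ^ n ∧ (k : ℚ) ≤ r * 2 ^ n ∧
    z = dyadic m a b n k}
  have key : ∀ {r : ℚ} {n k : ℕ}, k ≤ 2 ^ n → r * 2 ^ n ≤ k →
      sSup (S r) ≤ dyadic m a b n k := by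
    intro r n k hk hr
    apply sSup_le
    rintro _ ⟨n', k', hk', hr', rfl⟩
    rw [← dyadic_mul_two_pow m a b n n' k, ← dyadic_mul_two_pow m a b n' n k', add_comm n']
    refine dyadic_le hle hm hab ?_ ?_
    · have h1 : (k' : ℚ) * 2 ^ n ≤ r * 2 ^ n' * 2 ^ n := by gcongr
      have h2 : r * 2 ^ n * 2 ^ n' ≤ (k : ℚ) * 2 ^ n' := by gcongr
      have h3 : (k' : ℚ) * 2 ^ n ≤ k * 2 ^ n' := by linarith
      exact_mod_cast h3
    · rw [pow_add]
      gcongr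
  have := completelyBelow_of_rat (fun r => sSup (S r)) zero_lt_one fun r s h0 h h1 => by
    -- With mesh less than half of `s - r`, a full dyadic step starting at `⌈r * 2 ^ n⌉₊` fits
    -- between `r` and `s`.
    obtain ⟨n, hn⟩ := pow_unbounded_of_one_lt (2 / (s - r)) (one_lt_two : (1 : ℚ) < 2)
    rw [div_lt_iff₀ (sub_pos.2 h)] at hn
    have h2 : (0 : ℚ) < 2 ^ n := by positivity
    have hk := Nat.le_ceil (r * 2 ^ n)
    have hk' := Nat.ceil_lt_add_one (mul_nonneg h0 h2.le)
    have hs : ((⌈r * 2 ^ n⌉₊ + 1 : ℕ) : ℚ) ≤ s * 2 ^ n := by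
      push_cast
      linarith
    have hlt : ⌈r * 2 ^ n⌉₊ + 1 ≤ 2 ^ n := by
      have : ((⌈r * 2 ^ n⌉₊ + 1 : ℕ) : ℚ) ≤ (2 ^ n : ℕ) := by
        refine hs.trans ?_
        push_cast
        nlinarith
      exact_mod_cast this
    exact (hP _ _ (dyadic_rel hm hab n _ hlt)).mono (key (by omega) hk)
      (le_sSup ⟨n, _, hlt, hs, rfl⟩)
  refine this.mono (le_sSup ⟨0, 0, by simp, by simp, (dyadic_zero m a b 0).symm⟩) ?_
  exact (key (n := 0) (k := 1) (by simp) (by simp)).trans (dyadic_two_pow m a b 0).le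

/-! ### Compact regular locales. -/

section Compact

variable {L : Locale.{u}}

/-- In a finite subcover of `insert a S`, the members from `S` merge into one by `SupClosed`;
nonemptiness covers the case where there are none. -/
theorem compact.exists_sup_eq_top (hL : compact L) {S : Set L} (hne : S.Nonempty)
    (hS : SupClosed S) {a : L} (h : a ⊔ sSup S = ⊤) : ∃ x ∈ S, a ⊔ x = ⊤ := by
  obtain ⟨T, hTS, hT, hTtop⟩ := hL (insert a S) (by rwa [sSup_insert])
  suffices ∃ x ∈ S, sSup T ≤ a ⊔ x by
    obtain ⟨x, hx, hle⟩ := this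
    exact ⟨x, hx, top_le_iff.1 (hTtop.ge.trans hle)⟩
  clear hTtop
  induction T, hT using Set.Finite.induction_on with
  | empty =>
    obtain ⟨x, hx⟩ := hne
    exact ⟨x, hx, by simp⟩
  | @insert t T _ _ ih =>
    obtain ⟨x, hx, hle⟩ := ih ((Set.subset_insert _ _).trans hTS)
    rw [sSup_insert]
    rcases hTS (Set.mem_insert t T) with rfl | ht
    · exact ⟨x, hx, sup_le le_sup_left hle⟩
    · exact ⟨t ⊔ x, hS ht hx, sup_le (le_sup_of_le_right le_sup_left)
        (hle.trans (sup_le_sup_left le_sup_right _))⟩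

/-- By regularity `b` is the join of the directed set of `x ≺ b`, so compactness lets one such `x`
replace `b` in `aᶜ ⊔ b = ⊤`. -/
theorem exists_between_of_compact_regular (hc : compact L) (hr : regular L) {a b : L}
    (h : RatherBelow a b) : ∃ c, RatherBelow a c ∧ RatherBelow c b := by
  have h' : aᶜ ⊔ sSup {x : L | RatherBelow x b} = ⊤ := by rw [← hr b]; exact h
  obtain ⟨c, hcb, hac⟩ := hc.exists_sup_eq_top ⟨⊥, ratherBelow_bot b⟩
    (fun x hx y hy => by simpa using RatherBelow.sup hx hy) h'
  exact ⟨c, hac, hcb⟩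

theorem RatherBelow.completelyBelow (hc : compact L) (hr : regular L) {a b : L}
    (h : RatherBelow a b) : CompletelyBelow a b :=
  completelyBelow_of_interpolative RatherBelow (fun _ _ => id)
    (fun _ _ => exists_between_of_compact_regular hc hr) h

theorem completelyRegular_of_compact_regular (hc : compact L) (hr : regular L) :
    completelyRegular L := by
  intro a
  conv_lhs => rw [hr a]
  congr 1
  ext x
  exact ⟨fun h => h.completelyBelow hc hr, CompletelyBelow.ratherBelow⟩

end Compact

end Locale

/-! ### The diagonal: strongly Hausdorff versus regular. -/

namespace FrameCoprod

variable {A : Type u} [Order.Frame A]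

/-- The codiagonal of a frame. -/
abbrev codiag (A : Type u) [Order.Frame A] : FrameHom (Obj A A) A :=
  desc (FrameHom.id A) (FrameHom.id A)

theorem codiag_le_iff {U : Obj A A} {c : A} :
    codiag A U ≤ c ↔ ∀ x y, (x, y) ∈ U.1 → x ⊓ y ≤ c := by
  change (⨆ p ∈ U.1, p.1 ⊓ p.2) ≤ c ↔ _
  simp [iSup_le_iff]

/-- The complement of the diagonal in the square of a locale. -/
def offDiag (A : Type u) [Order.Frame A] : Obj A A :=
  ⟨⟨{p | p.1 ⊓ p.2 = ⊥}, fun _ _ h hp => le_bot_iff.1 ((inf_le_inf h.1 h.2).trans hp.le)⟩,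
    fun S b h => by
      change sSup S ⊓ b = ⊥
      rw [sSup_inf_eq]
      exact iSup₂_eq_bot.2 h,
    fun a S h => by
      change a ⊓ sSup S = ⊥
      rw [inf_sSup_eq]
      exact iSup₂_eq_bot.2 h⟩

theorem mem_offDiag {x y : A} : (x, y) ∈ (offDiag A).1 ↔ x ⊓ y = ⊥ := Iff.rfl

/-- So `offDiag A` is the right adjoint of `codiag A` at `⊥`: the closed complement of `offDiag A`
is the closure of the diagonal. -/
theorem codiag_eq_bot_iff {U : Obj A A} : codiag A U = ⊥ ↔ U ≤ offDiag A := by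
  rw [← le_bot_iff, codiag_le_iff, le_def]
  simp [mem_offDiag, Prod.forall]

end FrameCoprod

namespace Locale

open FrameCoprod

/-- For a compact locale, the right adjoint of the first coproduct inclusion, applied to
`offDiag ⊔ inr a`, is bounded by the join of the elements rather below `a`. -/
theorem le_of_inl_le_offDiag_sup_inr {L : Locale.{u}} (hc : compact L) {a b : L}
    (h : (inl b : Obj L L) ≤ offDiag L ⊔ inr a) : b ≤ sSup {x : L | RatherBelow x a} := by
  -- `E z` is the set of `x ≺ z`, with the witness `y` explicit.
  let E : L → Set L := fun z => {x | ∃ y, x ⊓ y = ⊥ ∧ y ⊔ z = ⊤}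
  have hE : ∀ {y₁ z x : L}, x ≤ sSup (E (y₁ ⊔ z)) →
      (∀ y', y' ⊔ (y₁ ⊔ z) = ⊤ → x ≤ sSup (E (y' ⊔ z))) → x ≤ sSup (E z) := by
    intro y₁ z x h₁ h₂
    rw [← inf_eq_left.2 h₁, inf_sSup_eq]
    refine iSup₂_le ?_
    rintro x' ⟨y', hx', hy'⟩
    refine (inf_le_inf_right _ (h₂ y' hy')).trans ?_
    rw [sSup_inf_eq]
    refine iSup₂_le ?_
    rintro x'' ⟨y'', hx'', hy''⟩
    refine le_sSup ⟨y'' ⊔ y', ?_, by rwa [sup_assoc]⟩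
    rw [inf_sup_left, inf_right_comm, hx'', bot_inf_eq, bot_sup_eq, inf_assoc, hx', inf_bot_eq]
  -- Quantifying over all `z ≥ a`, not just `a`, makes the condition on `p.2` stable under binary
  -- joins: part of a join can be moved into `z`, and `hE` recombines the pieces. Compactness then
  -- yields arbitrary joins.
  let W : Obj L L := ⟨⟨{p | ∀ z, a ≤ z → p.2 ⊔ z = ⊤ → p.1 ≤ sSup (E z)},
    fun p q h hp z haz hz => h.1.trans
      (hp z haz (top_le_iff.1 (hz.ge.trans (sup_le_sup_right h.2 z))))⟩,
    fun S y h z haz hz => sSup_le fun x hx => h x hx z haz hz,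
    fun x S h z haz hz => by
      let D : Set L := {y | ∀ z, a ≤ z → y ⊔ z = ⊤ → x ≤ sSup (E z)}
      have hD : SupClosed D := by
        intro y₁ h₁ y₂ h₂ z haz hz
        refine hE (y₁ := y₂) (h₁ _ (le_sup_of_le_right haz) ?_) fun y' hy' =>
          h₂ _ (le_sup_of_le_right haz) ?_
        · rwa [← sup_assoc]
        · rwa [sup_left_comm]
      have hbot : (⊥ : L) ∈ D := fun z _ hz => by
        have : z = ⊤ := by simpa using hz
        refine le_top.trans (le_sSup ⟨⊥, inf_bot_eq _, by simpa using this⟩)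
      obtain ⟨y, hy, hyz⟩ := hc.exists_sup_eq_top ⟨⊥, hbot⟩ hD (a := z)
        (top_le_iff.1 (hz.ge.trans (by
          rw [sup_comm]; exact sup_le_sup_left (sSup_le_sSup h) z)))
      exact hy z haz (by rwa [sup_comm])⟩
  have hW : offDiag L ⊔ inr a ≤ W := by
    refine sup_le ?_ ?_
    · rw [le_def]
      rintro ⟨x, y⟩ hxy z _ hz
      exact le_sSup ⟨y, hxy, hz⟩
    · refine tmul_le.2 fun z haz hz => ?_
      have : z = ⊤ := by rwa [sup_eq_right.2 haz] at hz
      exact le_sSup ⟨⊥, inf_bot_eq _, by simpa using this⟩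
  -- The pair `(b, ⊤)` lies in `W`; it is tested at `z = a`.
  refine (tmul_le.1 (h.trans hW) a le_rfl (by simp)).trans (sSup_le_sSup ?_)
  rintro x ⟨y, hxy, hy⟩
  exact ratherBelow_iff.2 ⟨y, by rwa [inf_comm], hy⟩

variable {L : Locale.{u}}

/-- The comparison of the concrete square of `L` with the chosen product. -/
noncomputable abbrev toSquare (L : Locale.{u}) : (prodFan L L).pt ⟶ L ⨯ L :=
  prod.lift (prodFan L L).fst (prodFan L L).snd

/-- The concrete diagonal of `L`. -/
abbrev concreteDiag (L : Locale.{u}) : L ⟶ (prodFan L L).pt := homOf (codiag L)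

/-- The comparison of the chosen square of `L` with the concrete one. -/
noncomputable abbrev ofSquare (L : Locale.{u}) : L ⨯ L ⟶ (prodFan L L).pt :=
  homOf (desc (frameHom prod.fst) (frameHom prod.snd))

theorem concreteDiag_fst : concreteDiag L ≫ (prodFan L L).fst = 𝟙 L :=
  hom_ext (desc_comp_inl (FrameHom.id L) (FrameHom.id L))

theorem concreteDiag_snd : concreteDiag L ≫ (prodFan L L).snd = 𝟙 L :=
  hom_ext (desc_comp_inr (FrameHom.id L) (FrameHom.id L))

theorem ofSquare_fst : ofSquare L ≫ (prodFan L L).fst = prod.fst :=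
  hom_ext (desc_comp_inl (frameHom prod.fst) (frameHom prod.snd))

theorem ofSquare_snd : ofSquare L ≫ (prodFan L L).snd = prod.snd :=
  hom_ext (desc_comp_inr (frameHom prod.fst) (frameHom prod.snd))

/-- `stronglyHausdorff` speaks of the chosen product, while computations take place in `Obj L L`;
this and the next two identities transport between them. -/
theorem concreteDiag_comp_toSquare : concreteDiag L ≫ toSquare L = diag L := by
  apply Limits.prod.hom_ext
  · exact (Category.assoc _ _ _).trans ((congr_arg _ (prod.lift_fst _ _)).trans
      (concreteDiag_fst.trans (prod.lift_fst _ _).symm))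
  · exact (Category.assoc _ _ _).trans ((congr_arg _ (prod.lift_snd _ _)).trans
      (concreteDiag_snd.trans (prod.lift_snd _ _).symm))

theorem ofSquare_comp_toSquare : ofSquare L ≫ toSquare L = 𝟙 _ := by
  apply Limits.prod.hom_ext
  · exact (Category.assoc _ _ _).trans ((congr_arg _ (prod.lift_fst _ _)).trans
      (ofSquare_fst.trans (Category.id_comp _).symm))
  · exact (Category.assoc _ _ _).trans ((congr_arg _ (prod.lift_snd _ _)).trans
      (ofSquare_snd.trans (Category.id_comp _).symm))

theorem toSquare_comp_ofSquare : toSquare L ≫ ofSquare L = 𝟙 _ := by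
  apply BinaryFan.IsLimit.hom_ext (prodFanIsLimit L L)
  · exact (Category.assoc _ _ _).trans ((congr_arg _ ofSquare_fst).trans
      ((prod.lift_fst _ _).trans (Category.id_comp _).symm))
  · exact (Category.assoc _ _ _).trans ((congr_arg _ ofSquare_snd).trans
      ((prod.lift_snd _ _).trans (Category.id_comp _).symm))

/-- Closedness makes `U`, lying above `direct f ⊥`, of the form `direct f b`. Being below such an
element is tested after applying `frameHom f`, which does not distinguish the two projections; hence
`frameHom prod.fst a ≤ U` as well. -/
theorem regular_of_compact_stronglyHausdorff (hc : compact L) (hs : stronglyHausdorff L) :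
    regular L := by
  intro a
  refine le_antisymm ?_ (sSup_le fun _ h => RatherBelow.le h)
  apply le_of_inl_le_offDiag_sup_inr hc
  set f := diag L
  let U : (L ⨯ L : Locale) := direct f ⊥ ⊔ frameHom prod.snd a
  obtain ⟨b, -, hb⟩ : U ∈ direct f '' Set.Ici ⊥ := by
    rw [hs]
    exact le_sup_left (a := direct f ⊥)
  have hfst : frameHom f (frameHom prod.fst a) = a :=
    DFunLike.congr_fun (congr_arg frameHom (prod.lift_fst (𝟙 L) (𝟙 L))) a
  have hsnd : frameHom f (frameHom prod.snd a) = a :=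
    DFunLike.congr_fun (congr_arg frameHom (prod.lift_snd (𝟙 L) (𝟙 L))) a
  have h1 : frameHom prod.fst a ≤ U := by
    rw [← hb, ← gc_direct, hfst, ← hsnd, gc_direct, hb]
    exact le_sup_right (a := direct f ⊥)
  have h2 := OrderHomClass.mono (frameHom (toSquare L)) h1
  have h3 : frameHom (toSquare L) (frameHom prod.fst a) = inl a :=
    DFunLike.congr_fun (congr_arg frameHom (prod.lift_fst _ _)) a
  have h4 : frameHom (toSquare L) (frameHom prod.snd a) = inr a :=
    DFunLike.congr_fun (congr_arg frameHom (prod.lift_snd _ _)) a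
  rw [map_sup, h3, h4] at h2
  refine h2.trans (sup_le_sup_right (codiag_eq_bot_iff.1 ?_) _)
  have h5 : codiag L (frameHom (toSquare L) (direct f ⊥)) = frameHom f (direct f ⊥) :=
    DFunLike.congr_fun (congr_arg frameHom (concreteDiag_comp_toSquare (L := L))) _
  rw [h5]
  exact le_bot_iff.1 ((gc_direct f).l_u_le ⊥)

/-- In the square of a regular locale, the two inclusions agree on the diagonal. -/
theorem inr_le_of_regular (hr : regular L) {U : Obj L L} (hU : offDiag L ≤ U) (a : L) :
    inr a ≤ U ⊔ inl a := by
  conv_lhs => rw [hr a]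
  rw [map_sSup, sSup_le_iff]
  rintro _ ⟨x, hx, rfl⟩
  -- As `x ≺ a`, the elements `xᶜ` and `a` cover; the part over `xᶜ` misses the diagonal.
  have : (inr x : Obj L L) = inl xᶜ ⊓ inr x ⊔ inl a ⊓ inr x := by
    rw [← inf_sup_right, ← map_sup, hx, map_top, top_inf_eq]
  rw [this]
  refine sup_le_sup ?_ inf_le_left
  rw [inl_inf_inr, tmul_le]
  exact le_def.1 hU _ (mem_offDiag.2 (compl_inf_self x))

theorem inl_le_of_regular (hr : regular L) {U : Obj L L} (hU : offDiag L ≤ U) (a : L) :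
    inl a ≤ U ⊔ inr a := by
  conv_lhs => rw [hr a]
  rw [map_sSup, sSup_le_iff]
  rintro _ ⟨x, hx, rfl⟩
  have : (inl x : Obj L L) = inl x ⊓ inr xᶜ ⊔ inl x ⊓ inr a := by
    rw [← inf_sup_left, ← map_sup, hx, map_top, inf_top_eq]
  rw [this]
  refine sup_le_sup ?_ inf_le_right
  rw [inl_inf_inr, tmul_le]
  exact le_def.1 hU _ (mem_offDiag.2 (inf_compl_self x))

/-- Modulo `U` the two inclusions agree, so the rectangle on `x` and `y` is bounded by `inr (x ⊓
y)`, and `inr (codiag L U)` is itself absorbed by `U`. -/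
theorem mem_of_inf_le_codiag (hr : regular L) {U : Obj L L} (hU : offDiag L ≤ U) {x y : L}
    (h : x ⊓ y ≤ codiag L U) : (x, y) ∈ U.1 := by
  have hcod : inr (codiag L U) ≤ U := by
    change inr (⨆ p ∈ U.1, p.1 ⊓ p.2) ≤ U
    simp only [map_iSup, map_inf]
    refine iSup₂_le fun p hp => ?_
    refine (inf_le_inf_right _ (inr_le_of_regular hr hU _)).trans ?_
    rw [inf_sup_right, inl_inf_inr]
    exact sup_le inf_le_left (tmul_le.2 hp)
  rw [← tmul_le, ← inl_inf_inr]
  calc inl x ⊓ inr y ≤ (U ⊔ inr x) ⊓ (U ⊔ inr y) :=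
        inf_le_inf (inl_le_of_regular hr hU x) le_sup_right
    _ = U ⊔ inr (x ⊓ y) := by rw [← sup_inf_left, map_inf]
    _ ≤ U := sup_le le_rfl ((OrderHomClass.mono _ h).trans hcod)

theorem stronglyHausdorff_of_regular (hr : regular L) : stronglyHausdorff L := by
  intro a
  set f := diag L
  have hret : ∀ c, frameHom f (frameHom prod.fst c) = c := fun c =>
    DFunLike.congr_fun (congr_arg frameHom (prod.lift_fst (𝟙 L) (𝟙 L))) c
  have hfU : ∀ U, frameHom f U = codiag L (frameHom (toSquare L) U) := fun U =>
    (DFunLike.congr_fun (congr_arg frameHom (concreteDiag_comp_toSquare (L := L))) U).symm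
  have hid : ∀ U, frameHom (ofSquare L) (frameHom (toSquare L) U) = U := fun U =>
    DFunLike.congr_fun (congr_arg frameHom (ofSquare_comp_toSquare (L := L))) U
  have hid' : ∀ U, frameHom (toSquare L) (frameHom (ofSquare L) U) = U := fun U =>
    DFunLike.congr_fun (congr_arg frameHom (toSquare_comp_ofSquare (L := L))) U
  have hle : ∀ U, direct f a ≤ U → direct f (frameHom f U) ≤ U := by
    intro U hU
    have hoff : offDiag L ≤ frameHom (toSquare L) U := by
      rw [← hid' (offDiag L)]
      refine OrderHomClass.mono _ (le_trans ?_ hU)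
      rw [← gc_direct, hfU]
      refine ((congr_arg (codiag L) (hid' _)).trans (codiag_eq_bot_iff.2 le_rfl)).le.trans bot_le
    refine (hid _).ge.trans (le_trans (OrderHomClass.mono _ (le_def.2 ?_)) (hid U).le)
    rintro ⟨x, y⟩ hxy
    refine mem_of_inf_le_codiag hr hoff ((codiag_le_iff.1 le_rfl x y hxy).trans ?_)
    rw [← hfU, ← hfU]
    exact (gc_direct f).l_u_le _
  ext U
  constructor
  · rintro ⟨b, hb, rfl⟩
    exact (gc_direct f).monotone_u hb
  · intro hU
    -- It remains that `a ≤ frameHom f U`, which holds because `a` is the restriction to the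
    -- diagonal of `frameHom prod.fst a ≤ direct f a`.
    refine ⟨frameHom f U, ?_, (hle U hU).antisymm ((gc_direct f).le_u_l U)⟩
    refine (hret a).ge.trans (OrderHomClass.mono _ (le_trans ?_ hU))
    exact (gc_direct f _ _).1 (hret a).le

end Locale

/-! ### Subframes. -/

/-- A subset of a frame that is closed under finite meets and arbitrary joins. -/
structure Subframe (F : Type u) [Order.Frame F] where
  /-- The underlying set of a subframe. -/
  carrier : Set F
  top_mem : ⊤ ∈ carrier
  inf_mem : ∀ a ∈ carrier, ∀ b ∈ carrier, a ⊓ b ∈ carrier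
  sSup_mem : ∀ s ⊆ carrier, sSup s ∈ carrier

namespace Subframe

variable {F G : Type u} [Order.Frame F] [Order.Frame G] (S : Subframe F)

theorem isLUB_sSup (s : Set S.carrier) :
    IsLUB s ⟨sSup (Subtype.val '' s), S.sSup_mem _ (by rintro _ ⟨a, -, rfl⟩; exact a.2)⟩ :=
  ⟨fun a ha => le_sSup (a := a.1) ⟨a, ha, rfl⟩, fun b hb => sSup_le (by
    rintro _ ⟨a, ha, rfl⟩
    exact hb ha)⟩

noncomputable instance : CompleteLattice S.carrier :=
  letI : SupSet S.carrier :=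
    ⟨fun s => ⟨sSup (Subtype.val '' s), S.sSup_mem _ (by rintro _ ⟨a, -, rfl⟩; exact a.2)⟩⟩
  { completeLatticeOfSup S.carrier S.isLUB_sSup with
    inf := fun a b => ⟨a ⊓ b, S.inf_mem _ a.2 _ b.2⟩
    le_inf := fun a b c (h : a.1 ≤ b.1) h' => le_inf (c := a.1) h h'
    inf_le_left := fun a b => inf_le_left (a := a.1)
    inf_le_right := fun a b => inf_le_right (a := a.1)
    top := ⟨⊤, S.top_mem⟩
    le_top := fun a => le_top (a := a.1) }

theorem coe_sSup (s : Set S.carrier) : (sSup s).1 = sSup (Subtype.val '' s) := rfl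

noncomputable instance : Order.Frame S.carrier :=
  Order.Frame.ofMinimalAxioms
    { inf_sSup_le_iSup_inf := fun a s => by
        change a.1 ⊓ sSup (Subtype.val '' s) ≤ (⨆ b ∈ s, a ⊓ b).1
        rw [inf_sSup_eq]
        refine iSup₂_le ?_
        rintro _ ⟨b, hb, rfl⟩
        exact le_iSup₂ (f := fun (b : S.carrier) (_ : b ∈ s) => a ⊓ b) b hb }

/-- The inclusion of a subframe. -/
noncomputable def incl : FrameHom S.carrier F where
  toFun := Subtype.val
  map_inf' _ _ := rfl
  map_top' := rfl
  map_sSup' _ := rfl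

theorem incl_injective : Function.Injective S.incl := Subtype.val_injective

/-- The corestriction of a frame homomorphism with values in a subframe. -/
noncomputable def corestrict (f : FrameHom G F) (h : ∀ x, f x ∈ S.carrier) :
    FrameHom G S.carrier where
  toFun x := ⟨f x, h x⟩
  map_inf' _ _ := Subtype.ext (map_inf f _ _)
  map_top' := Subtype.ext (map_top f)
  map_sSup' s := Subtype.ext ((map_sSup f s).trans (by
    rw [coe_sSup, Set.image_image]))

/-- The pseudocomplement of `F` may leave the subframe, so a witness inside `S` is demanded instead.
-/
theorem ratherBelow_iff {a b : Locale.of S.carrier} :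
    Locale.RatherBelow a b ↔ ∃ c ∈ S.carrier, c ⊓ a.1 = ⊥ ∧ c ⊔ b.1 = ⊤ := by
  rw [Locale.ratherBelow_iff]
  have hb : (⊥ : S.carrier).1 = ⊥ := map_bot S.incl
  have hs : ∀ c d : S.carrier, (c ⊔ d).1 = c.1 ⊔ d.1 := map_sup S.incl
  constructor
  · rintro ⟨c, h, h'⟩
    exact ⟨c.1, c.2, (congr_arg Subtype.val h).trans hb,
      (hs c b).symm.trans (congr_arg Subtype.val h')⟩
  · rintro ⟨c, hc, h, h'⟩
    exact ⟨⟨c, hc⟩, Subtype.ext (h.trans hb.symm), Subtype.ext ((hs ⟨c, hc⟩ b).trans h')⟩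

theorem compact (hF : Locale.compact (Locale.of F)) : Locale.compact (Locale.of S.carrier) := by
  intro s hs
  obtain ⟨T, hTs, hT, hTtop⟩ := hF (Subtype.val '' s) (congr_arg Subtype.val hs)
  obtain ⟨T', hT's, rfl⟩ := Set.subset_image_iff.1 hTs
  exact ⟨T', hT's, (Set.finite_image_iff Subtype.val_injective.injOn).1 hT, Subtype.ext hTtop⟩

end Subframe

/-! ### The completely regular reflection. -/

namespace Locale

/-- The subframe of those elements that are the join of the elements completely below them. -/
def crSubframe (L : Locale.{u}) : Subframe L where
  carrier := {a | a ≤ sSup {x : L | CompletelyBelow x a}}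
  top_mem := le_sSup (completelyBelow_top ⊤)
  inf_mem a ha b hb := by
    refine (inf_le_inf ha hb).trans ?_
    rw [sSup_inf_sSup]
    exact iSup₂_le fun p hp => le_sSup (CompletelyBelow.inf hp.1 hp.2)
  sSup_mem s hs := sSup_le fun a ha => (hs ha).trans
    (sSup_le_sSup fun _ hx => CompletelyBelow.mono hx le_rfl (le_sSup ha))

theorem sSup_mem_crSubframe {L : Locale.{u}} {S : Set L}
    (h : ∀ a ∈ S, ∃ b ∈ S, CompletelyBelow a b) : sSup S ∈ (crSubframe L).carrier :=
  sSup_le fun a ha => by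
    obtain ⟨b, hb, hab⟩ := h a ha
    exact le_sSup (hab.mono le_rfl (le_sSup hb))

theorem completelyRegular_crSubframe (L : Locale.{u}) :
    completelyRegular (Locale.of (crSubframe L).carrier) := by
  intro a
  refine le_antisymm ?_ (sSup_le fun _ h => CompletelyBelow.le h)
  change a.1 ≤ (sSup {x : (crSubframe L).carrier | CompletelyBelow (L := of _) x a}).1
  refine a.2.trans (sSup_le fun z hz => ?_)
  obtain ⟨x, rfl, hx1, hx⟩ := CompletelyBelow.exists_rat hz
  have hcb : ∀ {r s : ℚ}, 0 ≤ r → r < s → s ≤ 1 → CompletelyBelow (x r) (x s) :=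
    fun h0 h h1 => completelyBelow_of_rat x h fun p q hp hpq hq =>
      hx p q (h0.trans hp) hpq (hq.trans h1)
  -- The `x r` need not lie in the subframe. Joins over the open range `s < r` do, since every index
  -- has a later one; the witnesses for `≺` are open-ended joins of complements likewise.
  let y : ℚ → (crSubframe L).carrier := fun r =>
    ⟨sSup {z | ∃ s, 0 ≤ s ∧ s < r ∧ s < 1 ∧ z = x s}, sSup_mem_crSubframe (by
      rintro _ ⟨s, h0, hsr, h1, rfl⟩
      obtain ⟨t, hst, ht⟩ := exists_between (lt_min hsr h1)
      rw [lt_min_iff] at ht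
      exact ⟨x t, ⟨t, by linarith, ht.1, ht.2, rfl⟩, hcb h0 hst ht.2.le⟩)⟩
  -- The chain starts at `1 / 2` because `y 0` is an empty join, whereas `y (1 / 2)` dominates `x
  -- 0`.
  have := completelyBelow_of_rat (L := of (crSubframe L).carrier) y (p := 1 / 2) (q := 1)
    (by norm_num) fun r s h0 h h1 => by
      refine (Subframe.ratherBelow_iff _).2 ?_
      obtain ⟨q, hrq, hqs⟩ := exists_between h
      obtain ⟨t, hqt, hts⟩ := exists_between hqs
      obtain ⟨u, htu, hus⟩ := exists_between hts
      refine ⟨sSup {z | ∃ t, q < t ∧ t ≤ 1 ∧ z = (x t)ᶜ}, sSup_mem_crSubframe ?_, ?_, ?_⟩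
      · rintro _ ⟨t, hqt, ht, rfl⟩
        obtain ⟨t', h, h'⟩ := exists_between hqt
        exact ⟨_, ⟨t', h, by linarith, rfl⟩, (hcb (by linarith) h' ht).compl⟩
      · change sSup _ ⊓ sSup _ = ⊥
        rw [sSup_inf_sSup]
        refine le_bot_iff.1 (iSup₂_le ?_)
        rintro ⟨_, _⟩ ⟨⟨t, hqt, ht, rfl⟩, ⟨s, hs0, hsr, hs1, rfl⟩⟩
        refine (inf_le_inf_left _ (hcb hs0 (hsr.trans (hrq.trans hqt)) ht).le).trans ?_
        exact (compl_inf_self _).le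
      · refine top_le_iff.1 ((hx t u (by linarith) htu (by linarith)).ge.trans
          (sup_le_sup (le_sSup ⟨t, hqt, by linarith, rfl⟩) (le_sSup ⟨u, ?_⟩)))
        exact ⟨by linarith, hus, by linarith, rfl⟩
  refine le_trans (b := (y (1 / 2)).1) (le_sSup ⟨0, by norm_num⟩) (le_sSup ⟨y (1 / 2), ?_, rfl⟩)
  refine CompletelyBelow.mono this le_rfl ?_
  change sSup _ ≤ a.1
  refine sSup_le ?_
  rintro _ ⟨s, h0, h, h1, rfl⟩
  exact (hcb h0 h le_rfl).le.trans hx1.le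

/-- Frame homomorphisms preserve `≺≺`, so those from a completely regular frame land in `crSubframe
L`. -/
theorem exists_completelyRegular_reflection (L : Locale.{u}) :
    ∃ (C : Locale.{u}) (r : L ⟶ C), IsReflectionArrow completelyRegular r := by
  refine ⟨of (crSubframe L).carrier, homOf (crSubframe L).incl,
    completelyRegular_crSubframe L, fun Z hZ f => ?_⟩
  have hf : ∀ z, frameHom f z ∈ (crSubframe L).carrier := by
    intro z
    change frameHom f z ≤ _
    conv_lhs => rw [hZ z]
    rw [map_sSup, sSup_le_iff]
    rintro _ ⟨x, hx, rfl⟩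
    exact le_sSup (CompletelyBelow.map hx _)
  refine ⟨homOf ((crSubframe L).corestrict (frameHom f) hf), rfl, fun g hg => hom_ext ?_⟩
  ext z
  exact (crSubframe L).incl_injective (DFunLike.congr_fun (congr_arg frameHom hg) z)

/-! ### The frame of ideals. -/

/-- The ideals of a frame, as a sublocale of the frame of lower sets. -/
def ideals (F : Type u) [Order.Frame F] : Sublocale (LowerSet F) where
  carrier := {I | ⊥ ∈ I ∧ ∀ a ∈ I, ∀ b ∈ I, a ⊔ b ∈ I}
  sInf_mem' s hs := by
    simp only [Set.mem_ofPred_eq, LowerSet.mem_sInf_iff]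
    exact ⟨fun I hI => (hs hI).1, fun a ha b hb I hI => (hs hI).2 a (ha I hI) b (hb I hI)⟩
  himp_mem' U V hV := by
    have key : ∀ p : F, p ∈ U ⇨ V ↔ ∀ q ∈ U, p ⊓ q ∈ V := by
      intro p
      rw [← LowerSet.Iic_le, le_himp_iff]
      constructor
      · intro h q hq
        exact h ⟨(LowerSet.mem_Iic_iff.2 inf_le_left), U.lower inf_le_right hq⟩
      · rintro h q ⟨hq, hqU⟩
        have := h q hqU
        rwa [inf_eq_right.2 (LowerSet.mem_Iic_iff.1 hq)] at this
    simp only [Set.mem_ofPred_eq, key]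
    refine ⟨fun q _ => by rw [bot_inf_eq]; exact hV.1, fun a ha b hb q hq => ?_⟩
    rw [inf_sup_right]
    exact hV.2 _ (ha q hq) _ (hb q hq)

section Ideals

variable {F : Type u} [Order.Frame F]

theorem ideals_le {I J : ideals F} : I ≤ J ↔ ∀ a ∈ I.1, a ∈ J.1 := Iff.rfl

/-- An ideal given by a lower set containing `⊥` and closed under binary joins. -/
def mkIdeal (s : Set F) (hl : ∀ a b, b ≤ a → a ∈ s → b ∈ s) (hb : ⊥ ∈ s)
    (hs : ∀ a ∈ s, ∀ b ∈ s, a ⊔ b ∈ s) : ideals F :=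
  ⟨⟨s, hl⟩, hb, hs⟩

/-- A join of ideals is the union of its finite subjoins, so one of these already contains `⊤`. -/
theorem compact_ideals : compact (of (ideals F)) := by
  intro S hS
  let J : ideals F := mkIdeal {a | ∃ T ⊆ S, T.Finite ∧ a ∈ (sSup T : ideals F).1}
    (fun a b h ⟨T, hT, hf, ha⟩ => ⟨T, hT, hf, (sSup T : ideals F).1.lower h ha⟩)
    ⟨∅, Set.empty_subset _, Set.finite_empty, (sSup ∅ : ideals F).2.1⟩ (by
      rintro a ⟨T, hT, hf, ha⟩ b ⟨T', hT', hf', hb⟩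
      refine ⟨T ∪ T', Set.union_subset hT hT', hf.union hf', (sSup _ : ideals F).2.2 _ ?_ _ ?_⟩
      · exact ideals_le.1 (sSup_le_sSup Set.subset_union_left) _ ha
      · exact ideals_le.1 (sSup_le_sSup Set.subset_union_right) _ hb)
  have hJ : sSup S ≤ J := sSup_le fun I hI => ideals_le.2 fun a ha =>
    ⟨{I}, Set.singleton_subset_iff.2 hI, Set.finite_singleton I,
      ideals_le.1 (le_sSup (Set.mem_singleton I)) a ha⟩
  obtain ⟨T, hT, hf, h⟩ := ideals_le.1 (hS.ge.trans hJ) (⊤ : F) trivial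
  exact ⟨T, hT, hf, top_le_iff.1 (ideals_le.2 fun a _ => (sSup T : ideals F).1.lower le_top h)⟩

/-- The join map from the ideals of a frame to the frame. -/
def idealSup (F : Type u) [Order.Frame F] : FrameHom (ideals F) F :=
  FrameCoprod.homOfGC (fun I => sSup {a | a ∈ I.1})
    (fun a => mkIdeal (Set.Iic a) (fun _ _ h h' => h.trans h') bot_le
      fun _ h _ h' => sup_le h h')
    (fun I a => sSup_le_iff)
    (top_le_iff.1 (le_sSup trivial))
    (fun I J => by
      refine le_antisymm (le_inf (sSup_le_sSup fun a h => h.1) (sSup_le_sSup fun a h => h.2)) ?_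
      rw [sSup_inf_sSup]
      exact iSup₂_le fun p hp =>
        le_sSup ⟨I.1.lower inf_le_left hp.1, J.1.lower inf_le_right hp.2⟩)

theorem le_idealSup {I : ideals F} {a : F} (h : a ∈ I.1) : a ≤ idealSup F I := le_sSup h

theorem idealSup_le {I : ideals F} {a : F} : idealSup F I ≤ a ↔ ∀ b ∈ I.1, b ≤ a := sSup_le_iff

theorem eq_top_of_mem {I : ideals F} (h : ⊤ ∈ I.1) : I = ⊤ :=
  top_le_iff.1 (ideals_le.2 fun _ _ => I.1.lower le_top h)

theorem mem_bot_ideal {a : F} : a ∈ (⊥ : ideals F).1 ↔ a = ⊥ := by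
  constructor
  · intro h
    have hle : (⊥ : ideals F) ≤ mkIdeal {⊥} (fun a b h (ha : a = ⊥) => le_bot_iff.1 (h.trans ha.le))
      rfl (fun a (ha : a = ⊥) b (hb : b = ⊥) => by
        rw [ha, hb, sup_idem]
        rfl) := bot_le
    exact ideals_le.1 hle a h
  · rintro rfl
    exact (⊥ : ideals F).2.1

theorem exists_of_mem_sup {I J : ideals F} {a : F} (h : a ∈ (I ⊔ J).1) :
    ∃ b ∈ I.1, ∃ c ∈ J.1, a ≤ b ⊔ c := by
  let K : ideals F := mkIdeal {a | ∃ b ∈ I.1, ∃ c ∈ J.1, a ≤ b ⊔ c}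
    (fun a a' h ⟨b, hb, c, hc, ha⟩ => ⟨b, hb, c, hc, h.trans ha⟩)
    ⟨⊥, I.2.1, ⊥, J.2.1, bot_le⟩
    (fun a ⟨b, hb, c, hc, ha⟩ a' ⟨b', hb', c', hc', ha'⟩ =>
      ⟨b ⊔ b', I.2.2 _ hb _ hb', c ⊔ c', J.2.2 _ hc _ hc',
        (sup_le_sup ha ha').trans (sup_sup_sup_comm b c b' c').le⟩)
  have hK : I ⊔ J ≤ K := sup_le
    (ideals_le.2 fun a ha => ⟨a, ha, ⊥, J.2.1, le_sup_left⟩)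
    (ideals_le.2 fun a ha => ⟨⊥, I.2.1, a, ha, le_sup_right⟩)
  exact ideals_le.1 hK a h

end Ideals

/-! ### Regular ideals and the compact regular reflection. -/

variable {L : Locale.{u}}

/-- The subframe of ideals all of whose elements are completely below another element. -/
def regularIdeals (L : Locale.{u}) : Subframe (ideals L) where
  carrier := {I | ∀ a ∈ I.1, ∃ b ∈ I.1, CompletelyBelow a b}
  top_mem a _ := ⟨⊤, trivial, completelyBelow_top a⟩
  inf_mem I hI J hJ a ha := by
    obtain ⟨b, hb, hab⟩ := hI a ha.1
    obtain ⟨c, hc, hac⟩ := hJ a ha.2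
    exact ⟨b ⊓ c, ⟨I.1.lower inf_le_left hb, J.1.lower inf_le_right hc⟩,
      by simpa using hab.inf hac⟩
  sSup_mem S hS := by
    let K : ideals L := sSup S
    let J : ideals L := mkIdeal {a | ∃ b ∈ K.1, CompletelyBelow a b}
      (fun a b h ⟨c, hc, hac⟩ => ⟨c, hc, hac.mono h le_rfl⟩)
      ⟨⊥, K.2.1, completelyBelow_bot _⟩
      (fun a ⟨b, hb, hab⟩ c ⟨d, hd, hcd⟩ => ⟨b ⊔ d, K.2.2 b hb d hd, hab.sup hcd⟩)
    have : K ≤ J := sSup_le fun I hI => ideals_le.2 fun a ha => by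
      obtain ⟨b, hb, hab⟩ := hS hI a ha
      exact ⟨b, ideals_le.1 (le_sSup hI) b hb, hab⟩
    exact this

/-- The compact regular reflection of a locale: the frame of its regular ideals. -/
noncomputable abbrev stoneCech (L : Locale.{u}) : Locale.{u} := of (regularIdeals L).carrier

/-- The regular ideal of elements completely below `a`. -/
def belowIdeal (a : L) : (regularIdeals L).carrier :=
  ⟨mkIdeal {x | CompletelyBelow x a} (fun _ _ h h' => h'.mono h le_rfl) (completelyBelow_bot a)
    (fun x hx y hy => by simpa using CompletelyBelow.sup hx hy),
    fun _ hx => (CompletelyBelow.exists_between hx).imp fun _ h => h.symm⟩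

theorem mem_belowIdeal {a x : L} : x ∈ (belowIdeal a).1.1 ↔ CompletelyBelow x a := Iff.rfl

theorem compact_stoneCech (L : Locale.{u}) : compact (stoneCech L) :=
  (regularIdeals L).compact compact_ideals

theorem regularIdeals_le {I J : (regularIdeals L).carrier} :
    I ≤ J ↔ ∀ a ∈ I.1.1, a ∈ J.1.1 := Iff.rfl

/-- For `a ≺≺ b ≺≺ e ≺≺ d` with `d ∈ I`, the ideal below `b` contains `a` and is rather below `I`:
the witness `belowIdeal bᶜ` contains `eᶜ`, and `eᶜ ⊔ d = ⊤`. -/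
theorem regular_stoneCech (L : Locale.{u}) : regular (stoneCech L) := by
  intro I
  refine le_antisymm (regularIdeals_le.2 fun a ha => ?_) (sSup_le fun _ h => RatherBelow.le h)
  obtain ⟨d, hd, had⟩ := I.2 a ha
  obtain ⟨b, hab, hbd⟩ := had.exists_between
  obtain ⟨e, hbe, hed⟩ := hbd.exists_between
  refine regularIdeals_le.1 (le_sSup ?_) a (mem_belowIdeal.2 hab)
  refine (Subframe.ratherBelow_iff _).2 ⟨_, (belowIdeal bᶜ).2, ?_, ?_⟩
  · refine le_bot_iff.1 (ideals_le.2 fun x hx => mem_bot_ideal.2 ?_)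
    exact le_bot_iff.1 ((le_inf hx.1.le hx.2.le).trans (compl_inf_self b).le)
  · refine eq_top_of_mem ?_
    have h1 : eᶜ ∈ ((belowIdeal bᶜ).1 ⊔ I.1).1 :=
      ideals_le.1 (le_sup_left (a := (belowIdeal bᶜ).1)) _ (mem_belowIdeal.2 hbe.compl)
    have h2 : d ∈ ((belowIdeal bᶜ).1 ⊔ I.1).1 :=
      ideals_le.1 (le_sup_right (a := (belowIdeal bᶜ).1)) _ hd
    have := ((belowIdeal bᶜ).1 ⊔ I.1).2.2 _ h1 _ h2
    rwa [hed.ratherBelow] at this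

/-- The map from a locale to its compact regular reflection. -/
noncomputable def toStoneCech (L : Locale.{u}) : L ⟶ stoneCech L :=
  homOf ((idealSup L).comp (regularIdeals L).incl)

/-- A cover `u ⊔ v = ⊤` with `u` disjoint from all of `frameHom g a` and `v` in `frameHom g b` puts
the whole join of the former ideal below `v`. This lets the composite with `toStoneCech L` control
`g`. -/
theorem mem_of_ratherBelow {Z : Locale.{u}} (g : stoneCech L ⟶ Z) {a b : Z}
    (h : RatherBelow a b) : frameHom (toStoneCech L ≫ g) a ∈ (frameHom g b).1.1 := by
  obtain ⟨J, -, hJ, hJ'⟩ := (Subframe.ratherBelow_iff _).1 (h.map (frameHom g))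
  obtain ⟨u, hu, v, hv, huv⟩ := exists_of_mem_sup (hJ'.ge (trivial : (⊤ : L) ∈ (⊤ : ideals L).1))
  refine (frameHom g b).1.1.lower (idealSup_le.2 fun c hc => ?_) hv
  have hcu : u ⊓ c = ⊥ :=
    mem_bot_ideal.1 (hJ.le ⟨J.1.lower inf_le_left hu, ?_⟩)
  · calc c ≤ c ⊓ (u ⊔ v) := le_inf le_rfl (le_top.trans huv)
      _ ≤ v := by rw [inf_sup_left, inf_comm c u, hcu, bot_sup_eq]; exact inf_le_right
  · exact (frameHom g a).1.1.lower inf_le_right hc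

theorem toStoneCech_hom_ext {Z : Locale.{u}} (hZ : regular Z) {g g' : stoneCech L ⟶ Z}
    (h : toStoneCech L ≫ g = toStoneCech L ≫ g') : g = g' := by
  have key : ∀ {g g' : stoneCech L ⟶ Z}, toStoneCech L ≫ g = toStoneCech L ≫ g' →
      ∀ b, frameHom g b ≤ frameHom g' b := by
    intro g g' h b
    conv_lhs => rw [hZ b]
    rw [map_sSup, sSup_le_iff]
    rintro _ ⟨a, ha, rfl⟩
    refine regularIdeals_le.2 fun c hc => ?_
    have hmem := mem_of_ratherBelow g' ha
    rw [← h] at hmem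
    exact (frameHom g' b).1.1.lower (le_idealSup hc) hmem
  apply hom_ext
  ext b
  exact le_antisymm (key h b) (key h.symm b)

/-- The extension of a localic map to the compact regular reflection. -/
def extend {Z : Locale.{u}} (hc : compact Z) (hr : regular Z) (f : L ⟶ Z) :
    FrameHom Z (regularIdeals L).carrier where
  toFun b := ⟨mkIdeal {c | ∃ a, RatherBelow a b ∧ c ≤ frameHom f a}
    (fun c c' h ⟨a, ha, hc⟩ => ⟨a, ha, h.trans hc⟩) ⟨⊥, ratherBelow_bot b, bot_le⟩
    (fun c ⟨a, ha, hc⟩ c' ⟨a', ha', hc'⟩ => ⟨a ⊔ a', by simpa using ha.sup ha', by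
      rw [map_sup]; exact sup_le_sup hc hc'⟩), by
    rintro c ⟨a, ha, hca⟩
    obtain ⟨d, had, hdb⟩ := exists_between_of_compact_regular hc hr ha
    exact ⟨frameHom f d, ⟨d, hdb, le_rfl⟩,
      ((had.completelyBelow hc hr).map (frameHom f)).mono hca le_rfl⟩⟩
  map_inf' x y := by
    apply le_antisymm
    · rw [regularIdeals_le]
      rintro c ⟨a, ha, hca⟩
      exact ⟨⟨a, ha.mono le_rfl inf_le_left, hca⟩, ⟨a, ha.mono le_rfl inf_le_right, hca⟩⟩
    · rw [regularIdeals_le]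
      rintro c ⟨⟨a, ha, hca⟩, ⟨a', ha', hca'⟩⟩
      exact ⟨a ⊓ a', ha.inf ha', by rw [map_inf]; exact le_inf hca hca'⟩
  map_top' := Subtype.ext (eq_top_of_mem ⟨⊤, ratherBelow_top ⊤, by rw [map_top]⟩)
  map_sSup' s := by
    apply le_antisymm
    · rw [regularIdeals_le]
      rintro c ⟨a, ha, hca⟩
      set I : (regularIdeals L).carrier := sSup (_ '' s) with hI
      -- `D` is directed with join at least `sSup s`, so compactness reduces `a ≺ sSup s` to `a ≺ x`
      -- for a single `x ∈ D`.
      let D : Set Z := {x | frameHom f x ∈ I.1.1}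
      have hD : SupClosed D := fun x hx y hy => by
        change frameHom f (x ⊔ y) ∈ I.1.1
        rw [map_sup]
        exact I.1.2.2 _ hx _ hy
      have hbD : ∀ b ∈ s, ∀ x, RatherBelow x b → x ∈ D := fun b hb x hx =>
        by
        rw [Set.mem_ofPred_eq, hI]
        exact regularIdeals_le.1 (le_sSup (Set.mem_image_of_mem _ hb)) _ ⟨x, hx, le_rfl⟩
      have hsD : sSup s ≤ sSup D := sSup_le fun b hb =>
        (hr b).le.trans (sSup_le_sSup (hbD b hb))
      obtain ⟨x, hx, hax⟩ := hc.exists_sup_eq_top ⟨⊥, by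
        change frameHom f ⊥ ∈ I.1.1
        rw [map_bot]
        exact I.1.2.1⟩ hD (ha.mono le_rfl hsD)
      exact I.1.1.lower (hca.trans (OrderHomClass.mono _ (RatherBelow.le hax))) hx
    · rw [sSup_le_iff]
      rintro _ ⟨b, hb, rfl⟩
      rw [regularIdeals_le]
      rintro c ⟨a, ha, hca⟩
      exact ⟨a, ha.mono le_rfl (le_sSup hb), hca⟩

theorem toStoneCech_comp_extend {Z : Locale.{u}} (hc : compact Z) (hr : regular Z)
    (f : L ⟶ Z) : toStoneCech L ≫ homOf (extend hc hr f) = f := by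
  apply hom_ext
  ext b
  change idealSup L (extend hc hr f b).1 = _
  apply le_antisymm
  · rw [idealSup_le]
    rintro c ⟨a, ha, hca⟩
    exact hca.trans (OrderHomClass.mono _ ha.le)
  · conv_lhs => rw [hr b]
    rw [map_sSup, sSup_le_iff]
    rintro _ ⟨a, ha, rfl⟩
    exact le_idealSup ⟨a, ha, le_rfl⟩

theorem isReflectionArrow_toStoneCech (L : Locale.{u}) :
    IsReflectionArrow (compact ⊓ regular) (toStoneCech L) :=
  ⟨⟨compact_stoneCech L, regular_stoneCech L⟩, fun _ hZ f =>
    ⟨homOf (extend hZ.1 hZ.2 f), toStoneCech_comp_extend hZ.1 hZ.2 f, fun _ hg =>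
      toStoneCech_hom_ext hZ.2 (hg.trans (toStoneCech_comp_extend hZ.1 hZ.2 f).symm)⟩⟩

/-! ### Reflectivity of `KHLoc`. -/

theorem compact_inf_regular_eq :
    (compact.{u} ⊓ regular : ObjectProperty Locale.{u}) = compact ⊓ stronglyHausdorff := by
  ext L
  exact ⟨fun h => ⟨h.1, stronglyHausdorff_of_regular h.2⟩,
    fun h => ⟨h.1, regular_of_compact_stronglyHausdorff h.1 h.2⟩⟩

theorem isReflectionArrow_comp {L C B : Locale.{u}} {r : L ⟶ C} {s : C ⟶ B}
    (hr : IsReflectionArrow completelyRegular r) (hs : IsReflectionArrow (compact ⊓ regular) s) :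
    IsReflectionArrow (compact ⊓ stronglyHausdorff) (r ≫ s) := by
  rw [← compact_inf_regular_eq]
  refine ⟨hs.1, fun Z hZ f => ?_⟩
  obtain ⟨g, hg, hg'⟩ := hr.2 Z (completelyRegular_of_compact_regular hZ.1 hZ.2) f
  obtain ⟨k, hk, hk'⟩ := hs.2 Z hZ g
  refine ⟨k, ?_, fun k₁ h₁ => hk' _ (hg' _ ?_)⟩
  · exact (Category.assoc _ _ _).trans ((congr_arg _ hk).trans hg)
  · exact (Category.assoc _ _ _).symm.trans h₁

theorem isReflectionArrow_stoneCech_KH (L : Locale.{u}) :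
    IsReflectionArrow (compact ⊓ stronglyHausdorff) (toStoneCech L) :=
  compact_inf_regular_eq ▸ isReflectionArrow_toStoneCech L

/-- A reflection arrow is an initial object of the comma category, and these initial objects supply
the left adjoint. -/
theorem nonempty_reflective_inclKHLoc : Nonempty (Reflective inclKHLoc.{u}) := by
  have h : ∀ A : HLoc.{u}, HasInitial (StructuredArrow A inclKHLoc.{u}) := fun A => by
    have H := isReflectionArrow_stoneCech_KH A.obj
    let Y : KHLoc.{u} := ⟨stoneCech A.obj, H.1⟩
    let X : StructuredArrow A inclKHLoc.{u} :=
      StructuredArrow.mk (Y := Y) (ObjectProperty.homMk (toStoneCech A.obj))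
    refine (IsInitial.ofUniqueHom (X := X) (fun Z => StructuredArrow.homMk
      (ObjectProperty.homMk (H.2 _ Z.right.2 Z.hom.hom).choose) ?_) fun Z m => ?_).hasInitial
    · exact ObjectProperty.hom_ext _ (H.2 _ Z.right.2 Z.hom.hom).choose_spec.1
    · refine StructuredArrow.hom_ext _ _ (ObjectProperty.hom_ext _ ?_)
      exact (H.2 _ Z.right.2 Z.hom.hom).choose_spec.2 _
        (congr_arg InducedCategory.Hom.hom (StructuredArrow.w m))
  have := isRightAdjointOfStructuredArrowInitials inclKHLoc.{u}
  exact ⟨{ toFull := (ObjectProperty.fullyFaithfulιOfLE _).full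
           toFaithful := (ObjectProperty.fullyFaithfulιOfLE _).faithful
           L := _
           adj := Adjunction.ofIsRightAdjoint inclKHLoc.{u} }⟩

/-! ### Products of compact strongly Hausdorff locales. -/

/-- A binary fan in a full subcategory whose image is a limit up to isomorphism is a limit. -/
theorem nonempty_isLimit_of_iso {C : Type u} [Category.{v} C] {P : ObjectProperty C}
    {K K' R : P.FullSubcategory} {c : BinaryFan K.obj K'.obj} (hc : IsLimit c)
    (e : R.obj ≅ c.pt) {p : R ⟶ K} {p' : R ⟶ K'} (hp : e.hom ≫ c.fst = p.hom)
    (hp' : e.hom ≫ c.snd = p'.hom) : Nonempty (IsLimit (BinaryFan.mk p p')) := by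
  refine ⟨BinaryFan.IsLimit.mk _ (fun f g => ObjectProperty.homMk
    ((BinaryFan.IsLimit.lift' hc f.hom g.hom).1 ≫ e.inv)) (fun f g => ?_) (fun f g => ?_)
    (fun f g k h₁ h₂ => ?_)⟩
  · ext
    change (_ ≫ e.inv) ≫ p.hom = f.hom
    refine ((Category.assoc _ _ _).trans (congr_arg _ ?_)).trans
      (BinaryFan.IsLimit.lift' hc f.hom g.hom).2.1
    exact (e.inv_comp_eq).2 hp.symm
  · ext
    change (_ ≫ e.inv) ≫ p'.hom = g.hom
    refine ((Category.assoc _ _ _).trans (congr_arg _ ?_)).trans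
      (BinaryFan.IsLimit.lift' hc f.hom g.hom).2.2
    exact (e.inv_comp_eq).2 hp'.symm
  · ext
    rw [ObjectProperty.homMk_hom, Iso.eq_comp_inv]
    apply BinaryFan.IsLimit.hom_ext hc
    · rw [(BinaryFan.IsLimit.lift' hc f.hom g.hom).2.1, Category.assoc, hp, ← h₁]
      rfl
    · rw [(BinaryFan.IsLimit.lift' hc f.hom g.hom).2.2, Category.assoc, hp', ← h₂]
      rfl

/-- If both factors of a product lie in a subcategory in which the product has a reflection, then
the reflection arrow is invertible. -/
theorem exists_iso_of_isReflectionArrow {C : Type u} [Category.{v} C] {P : ObjectProperty C}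
    {K K' R : C} (hK : P K) (hK' : P K') {c : BinaryFan K K'} (hc : IsLimit c) {η : c.pt ⟶ R}
    (H : IsReflectionArrow P η) : Nonempty (R ≅ c.pt) := by
  obtain ⟨p, hp : η ≫ p = _, -⟩ := H.2 K hK c.fst
  obtain ⟨p', hp' : η ≫ p' = _, -⟩ := H.2 K' hK' c.snd
  obtain ⟨m, hm, hm'⟩ := BinaryFan.IsLimit.lift' hc p p'
  have hηm : η ≫ m = 𝟙 c.pt := by
    apply BinaryFan.IsLimit.hom_ext hc
    · rw [Category.assoc, hm]
      exact hp.trans (Category.id_comp _).symm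
    · rw [Category.assoc, hm']
      exact hp'.trans (Category.id_comp _).symm
  -- Both `m ≫ η` and the identity factor `η` through itself.
  have hmη : m ≫ η = 𝟙 _ := (H.2 _ H.1 η).unique
    (by rw [← Category.assoc, hηm, Category.id_comp]) (Category.comp_id _)
  exact ⟨⟨m, η, hmη, hηm⟩⟩

theorem exists_compact_isLimit (K K' : HLoc.{u}) (hK : compact K.obj) (hK' : compact K'.obj) :
    ∃ c : BinaryFan K K', compact c.pt.obj ∧ Nonempty (IsLimit c) := by
  have H := isReflectionArrow_stoneCech_KH (prodFan K.obj K'.obj).pt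
  obtain ⟨e⟩ := exists_iso_of_isReflectionArrow ⟨hK, K.2⟩ ⟨hK', K'.2⟩
    (prodFanIsLimit K.obj K'.obj) H
  let R : HLoc.{u} := ⟨_, H.1.2⟩
  exact ⟨BinaryFan.mk (P := R) (ObjectProperty.homMk (e.hom ≫ (prodFan K.obj K'.obj).fst))
    (ObjectProperty.homMk (e.hom ≫ (prodFan K.obj K'.obj).snd)), H.1.1,
    nonempty_isLimit_of_iso (prodFanIsLimit K.obj K'.obj) e rfl rfl⟩

theorem compact_of_iso {L M : Locale.{u}} (e : L ≅ M) (hL : compact L) : compact M := by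
  intro S hS
  have h1 : ∀ a, frameHom e.inv (frameHom e.hom a) = a := fun a =>
    DFunLike.congr_fun (congr_arg frameHom e.inv_hom_id) a
  obtain ⟨T, hTS, hT, hTtop⟩ := hL (frameHom e.hom '' S) (by rw [← map_sSup, hS, map_top])
  obtain ⟨T', hT', rfl⟩ := Set.subset_image_iff.1 hTS
  refine ⟨T', hT', Set.Finite.of_finite_image hT (Function.LeftInverse.injective h1).injOn, ?_⟩
  rw [← map_sSup] at hTtop
  rw [← h1 (sSup T'), hTtop, map_top]

end Locale

theorem mainTheorem8 :
    -- `KHLoc` is reflective in `HLoc`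
    Nonempty (Reflective Locale.inclKHLoc.{u}) ∧
    -- every locale has a completely regular reflection
    (∀ L : Locale.{u}, ∃ (C : Locale.{u}) (r : L ⟶ C),
      IsReflectionArrow Locale.completelyRegular r) ∧
    -- every completely regular locale has a compact regular reflection
    (∀ C : Locale.{u}, Locale.completelyRegular C → ∃ (B : Locale.{u}) (s : C ⟶ B),
      IsReflectionArrow (Locale.compact ⊓ Locale.regular) s) ∧
    -- for strongly Hausdorff `L`, the composite of the two is the reflection of `L` into `KHLoc`
    (∀ (L : Locale.HLoc.{u}) (C B : Locale.{u}) (r : L.obj ⟶ C) (s : C ⟶ B),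
      IsReflectionArrow Locale.completelyRegular r →
      IsReflectionArrow (Locale.compact ⊓ Locale.regular) s →
      IsReflectionArrow (Locale.compact ⊓ Locale.stronglyHausdorff) (r ≫ s)) ∧
    -- binary products in `HLoc` of compact objects exist and are compact
    (∀ K K' : Locale.HLoc.{u}, Locale.compact K.obj → Locale.compact K'.obj →
      HasBinaryProduct K K' ∧
      ∀ c : BinaryFan K K', Nonempty (IsLimit c) → Locale.compact c.pt.obj) := by
  refine ⟨Locale.nonempty_reflective_inclKHLoc, Locale.exists_completelyRegular_reflection,
    fun C _ => ⟨_, _, Locale.isReflectionArrow_toStoneCech C⟩,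
    fun _ _ _ _ _ hr hs => Locale.isReflectionArrow_comp hr hs, fun K K' hK hK' => ?_⟩
  obtain ⟨d, hd, ⟨hlim⟩⟩ := Locale.exists_compact_isLimit K K' hK hK'
  refine ⟨⟨⟨⟨d, hlim⟩⟩⟩, fun c ⟨hc⟩ => ?_⟩
  exact Locale.compact_of_iso
    ((ObjectProperty.ι _).mapIso (IsLimit.conePointUniqueUpToIso hlim hc)) hd
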